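/- Identify integer partitions with their Young diagrams and order them by containment (Young's lattice). For a partition $\lambda$ let $f_\lambda$ be the number of saturated chains from $\emptyset$ to $\lambda$ in Young's lattice, and call $\lambda$ odd if $f_\lambda$ is odd. A $t$-hook of $\lambda$ is the hook of a cell of $\lambda$ with hook length $t$ (number of cells strictly to the right of it in its row, plus number of cells strictly below it in its column, plus one); its leg-length is the number of cells strictly below the cell in its column. Removing a hook means deleting the corresponding rim hook. A $t$-core of $\lambda$ is a partition without $t$-hooks obtained from $\lambda$ by successively removing $t$-hooks. Let $n$ be a positive integer and let $k\ge 0$ be the integer with $2^k\le n<2^{k+1}$. (0) A partition $\lambda\vdash n$ has at most one $2^k$-hook; if it has one, then the partition obtained by removing it is a partition of $n-2^k$ and is the unique $2^k$-core of $\lambda$. (1) A partition $\lambda\vdash n$ is odd if and only if $\lambda$ has a $2^k$-hook and the partition of $n-2^k$ obtained from $\lambda$ by removing this hook (the $2^k$-core of $\lambda$) is odd. (2) An odd partition $\lambda\vdash n$ is uniquely determined by its $2^k$-core and the leg-length of its $2^k$-hook: two odd partitions of $n$ for which these data agree are equal. (3) Suppose $2^k<n<2^{k+1}$, let $\mu$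 be an odd partition of $n-1$, and let $\lambda$ be a partition of $n$ that has a $2^k$-hook (for instance, by (1), any odd partition of $n$). Then $\mu$ is covered by $\lambda$ if and only if the $2^k$-hooks of $\lambda$ and $\mu$ have the same leg-length and the $2^k$-core of $\mu$ is covered by the $2^k$-core of $\lambda$. -/

import Mathlib

namespace YoungDiagram

/-- The number `f_μ` of saturated chains from `∅` to `μ` in Young's lattice
(partitions ordered by containment of Young diagrams). -/
noncomputable def numChains (μ : YoungDiagram) : ℕ :=
  Nat.card {s : RelSeries {p : YoungDiagram × YoungDiagram | p.1 ⋖ p.2} //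
    s.head = ⊥ ∧ s.last = μ}

/-- A partition is odd if `f_μ` is odd. -/
def IsOdd (μ : YoungDiagram) : Prop :=
  Odd μ.numChains

/-- The number of cells of `μ` strictly to the right of the cell `c`, in its row. -/
def armLength (μ : YoungDiagram) (c : ℕ × ℕ) : ℕ :=
  μ.rowLen c.1 - (c.2 + 1)

/-- The number of cells of `μ` strictly below the cell `c`, in its column. -/
def legLength (μ : YoungDiagram) (c : ℕ × ℕ) : ℕ :=
  μ.colLen c.2 - (c.1 + 1)

/-- The hook length of the cell `c` of `μ`. -/
def hookLength (μ : YoungDiagram) (c : ℕ × ℕ) : ℕ :=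
  μ.armLength c + μ.legLength c + 1

/-- `c` is the corner cell of a `t`-hook of `μ`. -/
def IsHookAt (μ : YoungDiagram) (t : ℕ) (c : ℕ × ℕ) : Prop :=
  c ∈ μ ∧ μ.hookLength c = t

/-- The partition obtained from `μ` by removing the hook at the cell `c`, that is, by deleting
the corresponding rim hook: the cells weakly below and weakly to the right of `c` whose
diagonal successor is not in `μ`. -/
def removeHook (μ : YoungDiagram) (c : ℕ × ℕ) : YoungDiagram where
  cells := μ.cells.filter fun x => ¬ (c ≤ x ∧ (x.1 + 1, x.2 + 1) ∉ μ)
  isLowerSet := by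
    intro y x hxy hy
    simp only [Finset.coe_filter, Set.mem_ofPred_eq, mem_cells] at hy ⊢
    refine ⟨μ.isLowerSet hxy hy.1, fun hx => hy.2 ⟨hx.1.trans hxy, fun h => hx.2 ?_⟩⟩
    exact μ.up_left_mem (Nat.succ_le_succ hxy.1) (Nat.succ_le_succ hxy.2) h

/-- `ν` is obtained from `μ` by removing one `t`-hook. -/
def RemovesHook (t : ℕ) (μ ν : YoungDiagram) : Prop :=
  ∃ c, μ.IsHookAt t c ∧ ν = μ.removeHook c

/-- `ν` is a `t`-core of `μ`: it has no `t`-hook, and it is obtained from `μ` by successively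
removing `t`-hooks. -/
def IsCoreOf (t : ℕ) (ν μ : YoungDiagram) : Prop :=
  Relation.ReflTransGen (RemovesHook t) μ ν ∧ ∀ c, ¬ ν.IsHookAt t c

end YoungDiagram

/-! Encode `μ` by its Maya diagram: row `i` gives a bead at `rowLen i - i`, column `j` a gap at `j +
1 - colLen j`, and beads and gaps partition `ℤ`. A `t`-hook is a bead `x` with `x - t` vacant;
removing it moves the bead to `x - t`, and its leg-length counts the beads strictly between
(`IsHookAt.movesBead`, `IsHookAt.legLength_eq`). A cover is a bead move by one.

Oddness: let `hookSum t` sum a function over all removals of a `t`-hook. Modulo two, `hookSum t`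
applied twice is `hookSum (2 * t)`, because independent moves commute and cancel in pairs
(`hookSum_hookSum`). The chain count is fixed by `hookSum 1` on nonempty partitions, so modulo two
it equals its own sum over `2 ^ k`-hooks. For `n < 2 ^ (k + 1)` this sum has at most one term.

Uniqueness and covers: with `t = 2 ^ k`, the bead set of the core is closed under subtracting `t`,
so sliding a window of length `t` upwards never gains beads. Hence the leg-length determines which
bead was moved (`eq_of_beadCount_eq`). Covers are then compared by seeing how a move by one
interacts with a move by `t`. -/

namespace YoungDiagram

/-! ### Maya diagrams: beads, gaps and hook lengths -/

/-- The position of the bead of row `i` on the (charge zero) Maya diagram of `μ`. -/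
def bead (μ : YoungDiagram) (i : ℕ) : ℤ := μ.rowLen i - i

/-- The position of the gap of column `j` on the Maya diagram of `μ`. -/
def gap (μ : YoungDiagram) (j : ℕ) : ℤ := j + 1 - μ.colLen j

/-- The set of beads of the Maya diagram of `μ`. -/
def beads (μ : YoungDiagram) : Set ℤ := Set.range μ.bead

theorem bead_strictAnti (μ : YoungDiagram) : StrictAnti μ.bead := by
  intro a b h
  have := μ.rowLen_anti a b h.le
  simp only [bead]
  omega

theorem lt_rowLen_iff_lt_colLen {μ : YoungDiagram} {i j : ℕ} :
    j < μ.rowLen i ↔ i < μ.colLen j := by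
  rw [← mem_iff_lt_rowLen, mem_iff_lt_colLen]

theorem mem_iff_gap_lt_bead {μ : YoungDiagram} {i j : ℕ} : (i, j) ∈ μ ↔ μ.gap j < μ.bead i := by
  have := lt_rowLen_iff_lt_colLen (μ := μ) (i := i) (j := j)
  rw [mem_iff_lt_rowLen]
  simp only [gap, bead]
  omega

theorem bead_ne_gap (μ : YoungDiagram) (i j : ℕ) : μ.bead i ≠ μ.gap j := by
  have := lt_rowLen_iff_lt_colLen (μ := μ) (i := i) (j := j)
  simp only [gap, bead]
  omega

theorem bead_mem_beads (μ : YoungDiagram) (i : ℕ) : μ.bead i ∈ μ.beads := ⟨i, rfl⟩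

theorem gap_notMem_beads (μ : YoungDiagram) (j : ℕ) : μ.gap j ∉ μ.beads := by
  rintro ⟨i, h⟩
  exact μ.bead_ne_gap i j h

theorem exists_gap_eq {μ : YoungDiagram} {z : ℤ} (hz : z ∉ μ.beads) : ∃ j, μ.gap j = z := by
  have hne : ∀ i, μ.bead i ≠ z := fun i h => hz ⟨i, h⟩
  have hex : ∃ i, μ.bead i < z := by
    refine ⟨(μ.rowLen 0 - z).toNat + 1, ?_⟩
    have := μ.rowLen_anti 0 ((μ.rowLen 0 - z).toNat + 1) (Nat.zero_le _)
    simp only [bead]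
    omega
  classical
  obtain ⟨i, hi, hmin⟩ : ∃ i, μ.bead i < z ∧ ∀ r < i, z < μ.bead r :=
    ⟨Nat.find hex, Nat.find_spec hex, fun r hr =>
      lt_of_le_of_ne (not_lt.1 (Nat.find_min hex hr)) (hne r).symm⟩
  simp only [bead] at hi
  -- With `i` the first row whose bead is below `z`, the column sought has length `i`, so `z = j + 1
  -- - i`.
  refine ⟨(z - 1 + i).toNat, ?_⟩
  have hj : (((z - 1 + i).toNat : ℕ) : ℤ) = z - 1 + i := by omega
  have hcol : μ.colLen (z - 1 + i).toNat = i := by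
    apply le_antisymm
    · by_contra! h
      have := mem_iff_lt_rowLen.1 (mem_iff_lt_colLen.2 h)
      omega
    · rcases i with _ | r
      · exact Nat.zero_le _
      · have h := hmin r (Nat.lt_succ_self r)
        simp only [bead] at h
        apply Nat.succ_le_of_lt
        rw [← mem_iff_lt_colLen, mem_iff_lt_rowLen]
        push_cast at hj
        omega
  simp only [gap, hj, hcol]
  ring

theorem beads_injective : Function.Injective beads := by
  intro μ ν h
  have hr : μ.bead = ν.bead := by
    -- Dualizing `ℤ` makes both enumerations strictly increasing on `ℕ`, hence determined by their
    -- range.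
    have h1 := μ.bead_strictAnti.dual_right
    have h2 := ν.bead_strictAnti.dual_right
    have := (StrictMono.range_inj h1 h2).1 (by
      rw [Set.range_comp, Set.range_comp]
      exact congrArg _ h)
    exact this
  ext ⟨i, j⟩
  have := congrFun hr i
  simp only [bead] at this
  rw [mem_cells, mem_cells, mem_iff_lt_rowLen, mem_iff_lt_rowLen]
  omega

theorem hookLength_eq {μ : YoungDiagram} {i j : ℕ} (h : (i, j) ∈ μ) :
    (μ.hookLength (i, j) : ℤ) = μ.bead i - μ.gap j := by
  have h1 := mem_iff_lt_rowLen.1 h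
  have h2 := mem_iff_lt_colLen.1 h
  simp only [hookLength, armLength, legLength, bead, gap]
  omega

theorem IsHookAt.pos {μ : YoungDiagram} {t : ℕ} {c : ℕ × ℕ} (h : μ.IsHookAt t c) : 0 < t := by
  rw [← h.2]
  exact Nat.succ_pos _

theorem IsHookAt.gap_eq {μ : YoungDiagram} {t : ℕ} {c : ℕ × ℕ} (h : μ.IsHookAt t c) :
    μ.gap c.2 = μ.bead c.1 - t := by
  have := hookLength_eq (i := c.1) (j := c.2) h.1
  have h2 : μ.hookLength (c.1, c.2) = t := h.2
  omega

theorem IsHookAt.eq_of_bead_eq {μ : YoungDiagram} {t : ℕ} {c d : ℕ × ℕ} (hc : μ.IsHookAt t c)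
    (hd : μ.IsHookAt t d) (h : μ.bead c.1 = μ.bead d.1) : c = d := by
  have h1 := μ.bead_strictAnti.injective h
  refine Prod.ext h1 ?_
  have h2 : μ.gap c.2 = μ.gap d.2 := by rw [hc.gap_eq, hd.gap_eq, h]
  simp only [gap] at h2
  rcases lt_trichotomy c.2 d.2 with h3 | h3 | h3
  · have := μ.colLen_anti _ _ h3.le
    omega
  · exact h3
  · have := μ.colLen_anti _ _ h3.le
    omega

theorem exists_isHookAt {μ : YoungDiagram} {t : ℕ} {x : ℤ} (ht : 0 < t) (hx : x ∈ μ.beads)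
    (hxt : x - t ∉ μ.beads) : ∃ c, μ.IsHookAt t c ∧ μ.bead c.1 = x := by
  obtain ⟨i, rfl⟩ := hx
  obtain ⟨j, hj⟩ := exists_gap_eq hxt
  have hm : (i, j) ∈ μ := mem_iff_gap_lt_bead.2 (by omega)
  refine ⟨(i, j), ⟨hm, ?_⟩, rfl⟩
  have := hookLength_eq hm
  omega

/-! ### Removing a hook moves a bead -/

theorem mem_removeHook {μ : YoungDiagram} {c x : ℕ × ℕ} :
    x ∈ μ.removeHook c ↔ x ∈ μ ∧ ¬ (c ≤ x ∧ (x.1 + 1, x.2 + 1) ∉ μ) := by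
  change x ∈ (μ.removeHook c).cells ↔ _
  simp [removeHook]

/-- Deleting the rim hook shifts the rows it meets diagonally: each takes the next row's length
minus one, and the last one, row `colLen j - 1`, is cut back to `j`. -/
theorem rowLen_removeHook {μ : YoungDiagram} {i j : ℕ} (a : ℕ) :
    (μ.removeHook (i, j)).rowLen a =
      if a < i then μ.rowLen a else if a + 1 < μ.colLen j then μ.rowLen (a + 1) - 1
      else if a + 1 = μ.colLen j then j else μ.rowLen a := by
  refine eq_of_forall_lt_iff fun b => ?_
  rw [← mem_iff_lt_rowLen, mem_removeHook, mem_iff_lt_rowLen, mem_iff_lt_rowLen]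
  have h1 := lt_rowLen_iff_lt_colLen (μ := μ) (i := a) (j := j)
  have h2 := lt_rowLen_iff_lt_colLen (μ := μ) (i := a + 1) (j := j)
  have h5 := μ.rowLen_anti a (a + 1) (Nat.le_succ a)
  have h6 : ((i, j) : ℕ × ℕ) ≤ (a, b) ↔ i ≤ a ∧ j ≤ b := Iff.rfl
  rw [h6]
  dsimp only
  split_ifs <;> omega

theorem bead_removeHook {μ : YoungDiagram} {i j : ℕ} (a : ℕ) :
    (μ.removeHook (i, j)).bead a =
      if a < i then μ.bead a else if a + 1 < μ.colLen j then μ.bead (a + 1)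
      else if a + 1 = μ.colLen j then μ.gap j else μ.bead a := by
  have := lt_rowLen_iff_lt_colLen (μ := μ) (i := a + 1) (j := j)
  simp only [bead, gap, rowLen_removeHook]
  split_ifs <;> omega

theorem card_eq_sum_rowLen (μ : YoungDiagram) {N : ℕ} (hN : μ.colLen 0 ≤ N) :
    μ.card = ∑ a ∈ Finset.range N, μ.rowLen a := by
  have hmap : ∀ c ∈ μ.cells, c.1 ∈ Finset.range N := by
    intro c hc
    have h0 : (c.1, 0) ∈ μ := μ.up_left_mem le_rfl (Nat.zero_le _) hc
    exact Finset.mem_range.2 ((mem_iff_lt_colLen.1 h0).trans_le hN)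
  rw [YoungDiagram.card, Finset.card_eq_sum_card_fiberwise hmap]
  refine Finset.sum_congr rfl fun a _ => ?_
  rw [rowLen_eq_card, row]

theorem removeHook_le (μ : YoungDiagram) (c : ℕ × ℕ) : μ.removeHook c ≤ μ :=
  cells_subset_iff.1 (Finset.filter_subset _ _)

theorem colLen_mono {μ ν : YoungDiagram} (h : μ ≤ ν) (j : ℕ) : μ.colLen j ≤ ν.colLen j := by
  by_contra! hlt
  have h1 : (ν.colLen j, j) ∈ ν := h (mem_iff_lt_colLen.2 hlt)
  exact lt_irrefl _ (mem_iff_lt_colLen.1 h1)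

theorem IsHookAt.card_removeHook {μ : YoungDiagram} {t : ℕ} {c : ℕ × ℕ} (h : μ.IsHookAt t c) :
    (μ.removeHook c).card + t = μ.card := by
  obtain ⟨i, j⟩ := c
  have hm : (i, j) ∈ μ := h.1
  have hic := mem_iff_lt_colLen.1 hm
  have hc0 := μ.colLen_anti 0 j (Nat.zero_le j)
  have hg : μ.gap j = μ.bead i - t := h.gap_eq
  -- The bead differences telescope along the rim hook, to `bead i - gap j = t` once all its rows
  -- are included.
  have hpartial : ∀ m, ∑ a ∈ Finset.range m, (μ.bead a - (μ.removeHook (i, j)).bead a) =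
      if m ≤ i then 0 else if m + 1 ≤ μ.colLen j then μ.bead i - μ.bead m
      else μ.bead i - μ.gap j := by
    intro m
    induction m with
    | zero => simp
    | succ m ih =>
      rw [Finset.sum_range_succ, ih, bead_removeHook]
      rcases lt_trichotomy m i with h1 | rfl | h1
      · have : m ≤ i := h1.le
        have : m + 1 ≤ i := h1
        simp [*]
      all_goals
      split_ifs <;> omega
  have h1 := hpartial (μ.colLen 0)
  rw [if_neg (by omega), if_neg (by omega), hg] at h1
  have h2 := μ.card_eq_sum_rowLen le_rfl
  have h3 := (μ.removeHook (i, j)).card_eq_sum_rowLen (colLen_mono (μ.removeHook_le (i, j)) 0)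
  simp only [bead, Finset.sum_sub_distrib] at h1
  zify at h2 h3 ⊢
  rw [h2, h3]
  linarith

/-- `ν` is obtained from `μ` by moving the bead at `x` down to the gap at `y`. -/
structure MovesBead (μ ν : YoungDiagram) (x y : ℤ) : Prop where
  mem : x ∈ μ.beads
  notMem : y ∉ μ.beads
  lt : y < x
  mem_iff : ∀ z, z ∈ ν.beads ↔ z = y ∨ (z ∈ μ.beads ∧ z ≠ x)

theorem IsHookAt.movesBead {μ : YoungDiagram} {t : ℕ} {c : ℕ × ℕ} (h : μ.IsHookAt t c) :
    MovesBead μ (μ.removeHook c) (μ.bead c.1) (μ.bead c.1 - t) := by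
  obtain ⟨i, j⟩ := c
  have hm : (i, j) ∈ μ := h.1
  have hic := mem_iff_lt_colLen.1 hm
  have hg : μ.gap j = μ.bead i - t := h.gap_eq
  have ht := h.pos
  refine ⟨μ.bead_mem_beads i, ?_, by omega, fun z => ⟨?_, ?_⟩⟩
  · rw [← hg]
    exact μ.gap_notMem_beads j
  · rintro ⟨a, rfl⟩
    rw [bead_removeHook]
    have hne : ∀ r, r ≠ i → μ.bead r ≠ μ.bead i := fun r hr he =>
      hr (μ.bead_strictAnti.injective he)
    split_ifs with h1 h2 h3
    · exact Or.inr ⟨μ.bead_mem_beads _, hne _ h1.ne⟩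
    · exact Or.inr ⟨μ.bead_mem_beads _, hne _ (by omega)⟩
    · exact Or.inl hg
    · exact Or.inr ⟨μ.bead_mem_beads _, hne _ (by omega)⟩
  · rintro (rfl | ⟨⟨a, rfl⟩, ha⟩)
    · refine ⟨μ.colLen j - 1, ?_⟩
      rw [bead_removeHook, if_neg (by omega), if_neg (by omega), if_pos (by omega), hg]
    · have hai : a ≠ i := fun he => ha (by rw [he])
      by_cases h1 : a < i
      · exact ⟨a, by rw [bead_removeHook, if_pos h1]⟩
      · by_cases h2 : a < μ.colLen j
        · refine ⟨a - 1, ?_⟩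
          rw [bead_removeHook, if_neg (by omega), if_pos (by omega), Nat.sub_add_cancel (by omega)]
        · refine ⟨a, ?_⟩
          rw [bead_removeHook, if_neg h1, if_neg (by omega), if_neg (by omega)]

theorem IsHookAt.legLength_eq {μ : YoungDiagram} {t : ℕ} {c : ℕ × ℕ} (h : μ.IsHookAt t c) :
    μ.legLength c = (μ.beads ∩ Set.Ioo (μ.bead c.1 - t) (μ.bead c.1)).ncard := by
  obtain ⟨i, j⟩ := c
  have hg : μ.gap j = μ.bead i - t := h.gap_eq
  -- The beads in between are those of the rows below `i` that still reach column `j`.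
  have hset : μ.beads ∩ Set.Ioo (μ.bead i - t) (μ.bead i) =
      μ.bead '' (Finset.Ioo i (μ.colLen j) : Set ℕ) := by
    ext z
    constructor
    · rintro ⟨⟨a, rfl⟩, h1, h2⟩
      refine ⟨a, ?_, rfl⟩
      rw [← hg, ← mem_iff_gap_lt_bead, mem_iff_lt_colLen] at h1
      simpa using ⟨μ.bead_strictAnti.lt_iff_gt.1 h2, h1⟩
    · rintro ⟨a, ha, rfl⟩
      simp only [Finset.coe_Ioo, Set.mem_Ioo] at ha
      refine ⟨μ.bead_mem_beads a, ?_, μ.bead_strictAnti ha.1⟩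
      rw [← hg, ← mem_iff_gap_lt_bead, mem_iff_lt_colLen]
      exact ha.2
  change _ = (μ.beads ∩ Set.Ioo (μ.bead i - t) (μ.bead i)).ncard
  rw [hset, Set.ncard_image_of_injective _ μ.bead_strictAnti.injective, Set.ncard_coe_finset,
    Nat.card_Ioo, legLength]
  dsimp only
  omega

theorem MovesBead.unique {μ ν ν' : YoungDiagram} {x y : ℤ} (h : MovesBead μ ν x y)
    (h' : MovesBead μ ν' x y) : ν = ν' :=
  beads_injective (Set.ext fun z => by rw [h.mem_iff, h'.mem_iff])

theorem MovesBead.exists_isHookAt {μ ν : YoungDiagram} {x : ℤ} {t : ℕ}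
    (h : MovesBead μ ν x (x - t)) :
    ∃ c, μ.IsHookAt t c ∧ μ.bead c.1 = x ∧ ν = μ.removeHook c := by
  have := h.lt
  obtain ⟨c, hc, rfl⟩ := YoungDiagram.exists_isHookAt (by omega) h.mem h.notMem
  exact ⟨c, hc, rfl, h.unique hc.movesBead⟩

theorem MovesBead.card {μ ν : YoungDiagram} {x : ℤ} {t : ℕ} (h : MovesBead μ ν x (x - t)) :
    ν.card + t = μ.card := by
  obtain ⟨c, hc, -, rfl⟩ := h.exists_isHookAt
  exact hc.card_removeHook

theorem exists_movesBead {μ : YoungDiagram} {t : ℕ} {x : ℤ} (ht : 0 < t) (hx : x ∈ μ.beads)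
    (hxt : x - t ∉ μ.beads) : ∃ ν, MovesBead μ ν x (x - t) := by
  obtain ⟨c, hc, rfl⟩ := exists_isHookAt ht hx hxt
  exact ⟨_, hc.movesBead⟩

theorem covBy_iff_exists_isHookAt {μ ν : YoungDiagram} :
    ν ⋖ μ ↔ ∃ c, μ.IsHookAt 1 c ∧ ν = μ.removeHook c := by
  constructor
  · intro h
    have hss := cells_ssubset_iff.2 h.lt
    -- A cell of `μ` outside `ν` on the furthest antidiagonal is a corner of `μ`.
    obtain ⟨c, hc, hmax⟩ := (μ.cells \ ν.cells).exists_max_image (fun c => c.1 + c.2)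
      (Finset.sdiff_nonempty.2 hss.2)
    obtain ⟨i, j⟩ := c
    rw [Finset.mem_sdiff, mem_cells, mem_cells] at hc
    have h1 : (i + 1, j) ∉ μ := fun hm => by
      have := hmax (i + 1, j) (Finset.mem_sdiff.2 ⟨hm, fun hn =>
        hc.2 (ν.up_left_mem (Nat.le_succ i) le_rfl hn)⟩)
      dsimp only at this
      omega
    have h2 : (i, j + 1) ∉ μ := fun hm => by
      have := hmax (i, j + 1) (Finset.mem_sdiff.2 ⟨hm, fun hn =>
        hc.2 (ν.up_left_mem le_rfl (Nat.le_succ j) hn)⟩)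
      dsimp only at this
      omega
    rw [mem_iff_lt_colLen] at h1
    rw [mem_iff_lt_rowLen] at h2
    have hhook : μ.IsHookAt 1 (i, j) := by
      refine ⟨hc.1, ?_⟩
      simp only [hookLength, armLength, legLength]
      omega
    refine ⟨(i, j), hhook, ?_⟩
    have hle : ν ≤ μ.removeHook (i, j) := by
      intro x hx
      rw [← SetLike.mem_coe] at hx ⊢
      refine mem_removeHook.2 ⟨h.le hx, fun hcx => ?_⟩
      exact hc.2 (ν.up_left_mem hcx.1.1 hcx.1.2 hx)
    have hlt : μ.removeHook (i, j) < μ := by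
      refine lt_of_le_of_ne (μ.removeHook_le _) fun he => ?_
      have := hhook.card_removeHook
      rw [he] at this
      omega
    exact (h.eq_or_eq hle hlt.le).resolve_right hlt.ne |>.symm
  · rintro ⟨c, hc, rfl⟩
    have hcard := hc.card_removeHook
    have hlt : μ.removeHook c < μ := by
      refine lt_of_le_of_ne (μ.removeHook_le _) fun he => ?_
      rw [he] at hcard
      omega
    refine ⟨hlt, fun ν h1 h2 => ?_⟩
    have h3 := Finset.card_lt_card (cells_ssubset_iff.2 h1)
    have h4 := Finset.card_lt_card (cells_ssubset_iff.2 h2)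
    simp only [YoungDiagram.card] at hcard
    omega

theorem covBy_iff_movesBead {μ ν : YoungDiagram} :
    ν ⋖ μ ↔ ∃ b, MovesBead μ ν (b + 1) b := by
  rw [covBy_iff_exists_isHookAt]
  constructor
  · rintro ⟨c, hc, rfl⟩
    have := hc.movesBead
    refine ⟨μ.bead c.1 - 1, ?_⟩
    simpa using this
  · rintro ⟨b, h⟩
    have h' : MovesBead μ ν (b + 1) (b + 1 - (1 : ℕ)) := by simpa using h
    obtain ⟨c, hc, -, rfl⟩ := h'.exists_isHookAt
    exact ⟨c, hc, rfl⟩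

/-! ### Sums over hook removals, modulo two -/

/-- The beads of `μ` which can be moved down by `t`, that is, the `t`-hooks of `μ`. -/
def movable (μ : YoungDiagram) (t : ℕ) : Finset ℤ :=
  {c ∈ μ.cells | μ.hookLength c = t}.image fun c => μ.bead c.1

theorem mem_movable {μ : YoungDiagram} {t : ℕ} (ht : 0 < t) {x : ℤ} :
    x ∈ μ.movable t ↔ x ∈ μ.beads ∧ x - t ∉ μ.beads := by
  simp only [movable, Finset.mem_image, Finset.mem_filter, mem_cells]
  constructor
  · rintro ⟨c, hc, rfl⟩
    have h : μ.IsHookAt t c := hc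
    exact ⟨h.movesBead.mem, h.movesBead.notMem⟩
  · rintro ⟨h1, h2⟩
    obtain ⟨c, hc, rfl⟩ := exists_isHookAt ht h1 h2
    exact ⟨c, hc, rfl⟩

open Classical in
/-- The partition obtained from `μ` by moving the bead at `x` down by `t`, if this is possible. -/
noncomputable def slide (μ : YoungDiagram) (t : ℕ) (x : ℤ) : YoungDiagram :=
  if h : ∃ ν, MovesBead μ ν x (x - t) then h.choose else μ

theorem movesBead_slide {μ : YoungDiagram} {t : ℕ} (ht : 0 < t) {x : ℤ} (hx : x ∈ μ.movable t) :
    MovesBead μ (μ.slide t x) x (x - t) := by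
  rw [mem_movable ht] at hx
  have h := exists_movesBead ht hx.1 hx.2
  rw [slide, dif_pos h]
  exact h.choose_spec

theorem MovesBead.mem_movable {μ ν : YoungDiagram} {t : ℕ} {x : ℤ}
    (h : MovesBead μ ν x (x - t)) : x ∈ μ.movable t := by
  have := h.lt
  exact (YoungDiagram.mem_movable (by omega)).2 ⟨h.mem, h.notMem⟩

theorem MovesBead.slide_eq {μ ν : YoungDiagram} {t : ℕ} {x : ℤ}
    (h : MovesBead μ ν x (x - t)) : μ.slide t x = ν := by
  have := h.lt
  exact (movesBead_slide (by omega) h.mem_movable).unique h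

/-- Sum of the values of `F` at all partitions obtained by removing a `t`-hook. -/
noncomputable def hookSum {M : Type*} [AddCommMonoid M] (t : ℕ) (F : YoungDiagram → M)
    (μ : YoungDiagram) : M :=
  ∑ x ∈ μ.movable t, F (μ.slide t x)

theorem movable_slide {μ : YoungDiagram} {t : ℕ} (ht : 0 < t) {x y : ℤ} (hx : x ∈ μ.movable t) :
    y ∈ (μ.slide t x).movable t ↔
      (y = x - t ∨ (y ∈ μ.beads ∧ y ≠ x)) ∧ (y - t = x ∨ (y - t ∉ μ.beads ∧ y - t ≠ x - t)) := by
  have h := movesBead_slide ht hx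
  rw [mem_movable ht, h.mem_iff, h.mem_iff]
  have h1 := h.mem
  have h2 := h.lt
  constructor
  · rintro ⟨h3, h4⟩
    refine ⟨h3, ?_⟩
    tauto
  · rintro ⟨h3, h4⟩
    refine ⟨h3, ?_⟩
    rintro (h5 | h5)
    · rcases h4 with h4 | h4
      · omega
      · exact h4.2 h5
    · rcases h4 with h4 | h4
      · exact h5.2 h4
      · exact h4.1 h5.1

theorem mem_beads_slide_slide {μ : YoungDiagram} {t : ℕ} (ht : 0 < t) {x y : ℤ}
    (hx : x ∈ μ.movable t) (hy : y ∈ (μ.slide t x).movable t) (z : ℤ) :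
    z ∈ ((μ.slide t x).slide t y).beads ↔
      z = y - t ∨ ((z = x - t ∨ (z ∈ μ.beads ∧ z ≠ x)) ∧ z ≠ y) := by
  rw [(movesBead_slide ht hy).mem_iff, (movesBead_slide ht hx).mem_iff]

theorem slide_slide_comm {μ : YoungDiagram} {t : ℕ} (ht : 0 < t) {x y : ℤ}
    (hx : x ∈ μ.movable t) (hy : y ∈ (μ.slide t x).movable t) (h1 : y ≠ x - t) (h2 : y ≠ x + t) :
    y ∈ μ.movable t ∧ x ∈ (μ.slide t y).movable t ∧
      (μ.slide t y).slide t x = (μ.slide t x).slide t y := by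
  have hy' := (movable_slide ht hx).1 hy
  have h3 : y ∈ μ.beads ∧ y ≠ x := hy'.1.resolve_left h1
  have h4 : y - t ∉ μ.beads := (hy'.2.resolve_left (by omega)).1
  have hym : y ∈ μ.movable t := (mem_movable ht).2 ⟨h3.1, h4⟩
  have hx' := (mem_movable ht).1 hx
  have hxm : x ∈ (μ.slide t y).movable t := by
    rw [movable_slide ht hym]
    exact ⟨Or.inr ⟨hx'.1, h3.2.symm⟩, Or.inr ⟨hx'.2, by omega⟩⟩
  refine ⟨hym, hxm, beads_injective (Set.ext fun z => ?_)⟩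
  rw [mem_beads_slide_slide ht hym hxm, mem_beads_slide_slide ht hx hy]
  have : z = y - t → z ≠ x := by omega
  have : z = x - t → z ≠ y := by omega
  tauto

/-- Modulo two, removing two `t`-hooks amounts to removing a `2t`-hook. -/
theorem hookSum_hookSum {M : Type*} [AddCommGroup M] (hM : ∀ m : M, m + m = 0) {t : ℕ}
    (ht : 0 < t) (F : YoungDiagram → M) : hookSum t (hookSum t F) = hookSum (2 * t) F := by
  classical
  funext μ
  simp only [hookSum]
  rw [Finset.sum_sigma']
  -- Two successive moves interact only when `y = x - t` or `y = x + t`; all other pairs cancel by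
  -- swapping the order.
  rw [← Finset.sum_filter_add_sum_filter_not _ (fun p : Σ _ : ℤ, ℤ => p.2 = p.1 - t ∨ p.2 = p.1 + t)]
  have hzero : ∑ p ∈ (μ.movable t).sigma fun x => (μ.slide t x).movable t with
      ¬ (p.2 = p.1 - (t : ℤ) ∨ p.2 = p.1 + (t : ℤ)), F ((μ.slide t p.1).slide t p.2) = 0 := by
    refine Finset.sum_involution (fun p _ => ⟨p.2, p.1⟩) ?_ ?_ ?_ ?_
    · rintro ⟨x, y⟩ h
      simp only [Finset.mem_filter, Finset.mem_sigma, not_or] at h ⊢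
      rw [(slide_slide_comm ht h.1.1 h.1.2 h.2.1 h.2.2).2.2, hM]
    · rintro ⟨x, y⟩ h - he
      simp only [Finset.mem_filter, Finset.mem_sigma, not_or] at h
      have hne : y = x := congrArg Sigma.fst he
      have := (movable_slide ht h.1.1).1 h.1.2
      omega
    · rintro ⟨x, y⟩ h
      simp only [Finset.mem_filter, Finset.mem_sigma, not_or] at h ⊢
      have := slide_slide_comm ht h.1.1 h.1.2 h.2.1 h.2.2
      exact ⟨⟨this.1, this.2.1⟩, by omega, by omega⟩
    · rintro ⟨x, y⟩ h
      rfl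
  rw [hzero, add_zero]
  have h2t : 0 < 2 * t := by omega
  have hcast : ((2 * t : ℕ) : ℤ) = 2 * t := by push_cast; ring
  -- Each `2t`-hook, at bead `z`, arises from exactly one interacting pair: if `z - t` is occupied,
  -- that bead moves first and `z` takes its place; otherwise `z` moves twice.
  refine Finset.sum_bij' (fun p _ => max p.1 p.2)
    (fun z _ => if z - t ∈ μ.beads then ⟨z - t, z⟩ else ⟨z, z - t⟩) ?_ ?_ ?_ ?_ ?_
  · rintro ⟨x, y⟩ h
    simp only [Finset.mem_filter, Finset.mem_sigma] at h
    obtain ⟨⟨hx, hy⟩, hxy⟩ := h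
    rw [movable_slide ht hx] at hy
    rw [mem_movable ht] at hx
    rw [mem_movable h2t, hcast]
    dsimp only
    rcases hxy with rfl | rfl
    · rw [max_eq_left (by omega)]
      refine ⟨hx.1, fun h => ?_⟩
      rcases hy.2 with h' | h'
      · omega
      · exact h'.1 (by convert h using 1; ring)
    · rw [max_eq_right (by omega)]
      refine ⟨(hy.1.resolve_left (by omega)).1, fun h => hx.2 ?_⟩
      convert h using 1
      ring
  · intro z hz
    rw [mem_movable h2t, hcast] at hz
    have hz2 : z - t - t ∉ μ.beads := fun h => hz.2 (by convert h using 1; ring)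
    simp only [Finset.mem_filter, Finset.mem_sigma]
    split_ifs with h
    · have hm : z - t ∈ μ.movable t := (mem_movable ht).2 ⟨h, hz2⟩
      exact ⟨⟨hm, (movable_slide ht hm).2 ⟨Or.inr ⟨hz.1, (by omega : z ≠ z - t)⟩, Or.inl rfl⟩⟩,
        Or.inr (sub_add_cancel z t).symm⟩
    · have hm : z ∈ μ.movable t := (mem_movable ht).2 ⟨hz.1, h⟩
      exact ⟨⟨hm, (movable_slide ht hm).2 ⟨Or.inl rfl, Or.inr ⟨hz2, (by omega : z - t - t ≠ z - t)⟩⟩⟩, Or.inl rfl⟩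
  · rintro ⟨x, y⟩ h
    simp only [Finset.mem_filter, Finset.mem_sigma] at h
    obtain ⟨⟨hx, hy⟩, hxy⟩ := h
    rw [mem_movable ht] at hx
    dsimp only
    rcases hxy with rfl | rfl
    · rw [max_eq_left (by omega), if_neg hx.2]
    · rw [max_eq_right (by omega), add_sub_cancel_right, if_pos hx.1]
  · intro z hz
    split_ifs
    · exact max_eq_right (show z - t ≤ z by omega)
    · exact max_eq_left (show z - t ≤ z by omega)
  · rintro ⟨x, y⟩ h
    simp only [Finset.mem_filter, Finset.mem_sigma] at h
    obtain ⟨⟨hx, hy⟩, hxy⟩ := h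
    have hs := mem_beads_slide_slide ht hx hy
    have hy' := (movable_slide ht hx).1 hy
    have hx' := (mem_movable ht).1 hx
    congr 1
    symm
    rcases hxy with rfl | rfl
    · rw [max_eq_left (show x - t ≤ x by omega)]
      refine MovesBead.slide_eq ⟨hx'.1, ?_, by omega, fun z => ?_⟩
      · intro h
        rcases hy'.2 with h' | h'
        · omega
        · exact h'.1 (by convert h using 1; push_cast; ring)
      · rw [hs z]
        have h1 : z = x - t - t ↔ z = x - (2 * t : ℕ) := by omega
        have h2 : z ∈ μ.beads → z ≠ x - t := fun h e => hx'.2 (e ▸ h)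
        tauto
    · rw [max_eq_right (show x ≤ x + t by omega)]
      have hxt := hy'.1.resolve_left (by omega)
      refine MovesBead.slide_eq ⟨hxt.1, fun h => hx'.2 ?_, by omega, fun z => ?_⟩
      · convert h using 1
        push_cast
        ring
      · rw [hs z]
        have h1 : z = x + t - (2 * t : ℕ) ↔ z = x - t := by omega
        have h2 : z = x + t - t ↔ z = x := by omega
        rw [h1, h2]
        by_cases h3 : z = x
        · have h4 : z ∈ μ.beads := h3 ▸ hx'.1
          have h5 : z ≠ x + t := by omega
          have h6 : z ≠ x - t := by omega
          tauto
        · have h4 : z = x - t → z ≠ x + t := by omega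
          tauto

theorem hookSum_two_pow {M : Type*} [AddCommGroup M] (hM : ∀ m : M, m + m = 0) (k : ℕ) :
    hookSum (2 ^ k) = (hookSum 1 : (YoungDiagram → M) → YoungDiagram → M)^[2 ^ k] := by
  induction k with
  | zero => rfl
  | succ k ih =>
    funext F
    rw [pow_succ', ← hookSum_hookSum hM (by positivity), two_mul, Function.iterate_add_apply, ← ih]

/-- The bound `j ≤ μ.card` keeps the recursion away from the empty partition, where `hookSum 1 F` is
zero but `F` need not be. -/
theorem iterate_hookSum_one {M : Type*} [AddCommMonoid M] {F : YoungDiagram → M}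
    (hF : ∀ μ, 0 < μ.card → F μ = hookSum 1 F μ) (j : ℕ) :
    ∀ μ : YoungDiagram, j ≤ μ.card → (hookSum 1)^[j] F μ = F μ := by
  induction j with
  | zero => intro μ _; rfl
  | succ j ih =>
    intro μ hμ
    rw [Function.iterate_succ_apply', hF μ (by omega), hookSum, hookSum]
    refine Finset.sum_congr rfl fun x hx => ih _ ?_
    have := (movesBead_slide one_pos hx).card
    omega

/-! ### Recursion for the number of saturated chains -/

/-- The saturated chains from `∅` to `μ` in Young's lattice. -/
abbrev Chains (μ : YoungDiagram) : Type :=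
  {s : RelSeries {p : YoungDiagram × YoungDiagram | p.1 ⋖ p.2} // s.head = ⊥ ∧ s.last = μ}

theorem length_ne_zero_of_chain {μ : YoungDiagram} (hμ : μ ≠ ⊥) (s : Chains μ) :
    s.1.length ≠ 0 := by
  intro h
  have h1 : s.1.head = s.1.last := congrArg s.1.toFun (Fin.ext (by simp [h]))
  rw [s.2.1, s.2.2] at h1
  exact hμ h1.symm

/-- The last term of a chain recovers `ν`, so equality in the sigma type can be tested on the
underlying series. -/
theorem chain_sigma_injective (μ : YoungDiagram) : Function.Injective
    fun p : Σ ν : {ν : YoungDiagram // ν ⋖ μ}, Chains ν.1 => p.2.1 := by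
  rintro ⟨⟨ν, hν⟩, ⟨s, h1, h2⟩⟩ ⟨⟨ν', hν'⟩, ⟨s', h1', h2'⟩⟩ (rfl : s = s')
  obtain rfl : ν = ν' := h2.symm.trans h2'
  rfl

/-- Removing the last element of a saturated chain. -/
noncomputable def chainsEquiv {μ : YoungDiagram} (hμ : μ ≠ ⊥) :
    Chains μ ≃ Σ ν : {ν : YoungDiagram // ν ⋖ μ}, Chains ν.1 where
  toFun s := ⟨⟨s.1.eraseLast.last, by
      have := s.1.eraseLast_last_rel_last (length_ne_zero_of_chain hμ s)
      rw [s.2.2] at this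
      exact this⟩, ⟨s.1.eraseLast, s.2.1, rfl⟩⟩
  invFun p := ⟨p.2.1.snoc μ (by
      have := p.1.2
      rw [← p.2.2.2] at this
      exact this), by simpa using p.2.2.1, by simp⟩
  left_inv s := by
    obtain ⟨s, h1, rfl⟩ := s
    apply Subtype.ext
    exact s.snoc_self_eraseLast (length_ne_zero_of_chain hμ ⟨s, h1, rfl⟩)
  right_inv p := by
    apply chain_sigma_injective
    apply RelSeries.toList_injective
    dsimp only
    rw [RelSeries.toList_eraseLast _ (by simp [RelSeries.snoc, RelSeries.append]), RelSeries.toList_snoc]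
    simp

theorem mem_image_slide_iff_covBy {μ ν : YoungDiagram} [DecidableEq YoungDiagram] :
    ν ∈ (μ.movable 1).image (μ.slide 1) ↔ ν ⋖ μ := by
  rw [covBy_iff_movesBead, Finset.mem_image]
  constructor
  · rintro ⟨x, hx, rfl⟩
    exact ⟨x - 1, by simpa using movesBead_slide one_pos hx⟩
  · rintro ⟨b, h⟩
    have h' : MovesBead μ ν (b + 1) (b + 1 - (1 : ℕ)) := by simpa using h
    exact ⟨_, h'.mem_movable, h'.slide_eq⟩

theorem finite_covBy (μ : YoungDiagram) : Finite {ν : YoungDiagram // ν ⋖ μ} := by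
  classical
  exact Set.Finite.to_subtype (((μ.movable 1).image (μ.slide 1)).finite_toSet.subset
    fun ν hν => Finset.mem_coe.2 (mem_image_slide_iff_covBy.2 hν))

theorem card_pos_iff_ne_bot {μ : YoungDiagram} : 0 < μ.card ↔ μ ≠ ⊥ := by
  rw [YoungDiagram.card, Finset.card_pos, Finset.nonempty_iff_ne_empty, ne_eq, ne_eq,
    YoungDiagram.ext_iff, cells_bot]

/-- Without finiteness `Nat.card` would be the default `0` and the recursion would not follow from
`chainsEquiv`. -/
theorem finite_chains (μ : YoungDiagram) : Finite (Chains μ) := by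
  induction h : μ.card using Nat.strong_induction_on generalizing μ with
  | _ n ih =>
    by_cases hμ : μ = ⊥
    · subst hμ
      have hlen : ∀ s : Chains ⊥, s.1.length = 0 := by
        intro s
        by_contra hs
        have h1 := s.1.eraseLast_last_rel_last hs
        rw [s.2.2] at h1
        have h2 : s.1.eraseLast.last ⋖ ⊥ := h1
        exact not_lt_bot h2.lt
      have : Subsingleton (Chains ⊥) := by
        refine ⟨fun s s' => Subtype.ext (RelSeries.ext ((hlen s).trans (hlen s').symm) ?_)⟩
        funext i
        have hi : i = 0 := Fin.ext (by have := i.2; have := hlen s; simp only [Fin.val_zero]; omega)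
        subst hi
        exact s.2.1.trans s'.2.1.symm
      infer_instance
    · have := finite_covBy μ
      have : ∀ ν : {ν : YoungDiagram // ν ⋖ μ}, Finite (Chains ν.1) := fun ν =>
        ih _ (h ▸ Finset.card_lt_card (cells_ssubset_iff.2 ν.2.lt)) _ rfl
      exact Finite.of_equiv _ (chainsEquiv hμ).symm

theorem slide_injOn {μ : YoungDiagram} {t : ℕ} (ht : 0 < t) :
    Set.InjOn (μ.slide t) (μ.movable t) := by
  intro x hx y hy h
  have h1 := movesBead_slide ht hx
  have h2 := movesBead_slide ht hy
  rw [h] at h1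
  by_contra hne
  have h3 := (h1.mem_iff x).1.mt (by have := h1.lt; rintro (h | h) <;> omega)
  exact h3 ((h2.mem_iff x).2 (Or.inr ⟨h1.mem, hne⟩))

theorem numChains_eq_hookSum {μ : YoungDiagram} (hμ : 0 < μ.card) :
    μ.numChains = hookSum 1 numChains μ := by
  classical
  have := finite_chains
  let _ : Fintype {ν : YoungDiagram // ν ⋖ μ} :=
    Fintype.subtype _ fun ν => mem_image_slide_iff_covBy
  have h1 : μ.numChains = ∑ ν : {ν : YoungDiagram // ν ⋖ μ}, ν.1.numChains := by
    change Nat.card (Chains μ) = _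
    rw [Nat.card_congr (chainsEquiv (card_pos_iff_ne_bot.1 hμ)), Nat.card_sigma]
    rfl
  rw [h1, hookSum, ← Finset.sum_subtype _ fun ν => mem_image_slide_iff_covBy,
    Finset.sum_image (slide_injOn one_pos)]

/-- The number of saturated chains modulo two, as a sum over `2 ^ k`-hooks. -/
theorem numChains_mod_two {μ : YoungDiagram} {k : ℕ} (hk : 2 ^ k ≤ μ.card) :
    (μ.numChains : ZMod 2) = hookSum (2 ^ k) (fun ν => (ν.numChains : ZMod 2)) μ := by
  rw [hookSum_two_pow CharTwo.add_self_eq_zero, iterate_hookSum_one _ _ _ hk]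
  intro ν hν
  rw [numChains_eq_hookSum hν, hookSum, hookSum, Nat.cast_sum]

/-! ### Leg-lengths on cores -/

/-- The number of beads strictly between `x - t` and `x`. -/
noncomputable def beadCount (X : Set ℤ) (t : ℕ) (x : ℤ) : ℕ :=
  (X ∩ Set.Ioo (x - t) x).ncard

theorem finite_inter_Ioo (X : Set ℤ) (a b : ℤ) : (X ∩ Set.Ioo a b).Finite :=
  (Set.finite_Ioo a b).inter_of_right X

theorem ncard_inter_Ico_of_mem {X : Set ℤ} {t : ℕ} (ht : 0 < t) {m : ℤ} (hm : m - t ∈ X) :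
    (X ∩ Set.Ico (m - t) m).ncard = beadCount X t m + 1 := by
  have h : X ∩ Set.Ico (m - t) m = insert (m - t) (X ∩ Set.Ioo (m - t) m) := by
    rw [← Set.Ioo_insert_left (by omega), Set.inter_insert_of_mem hm]
  rw [h, Set.ncard_insert_of_notMem (by simp) (finite_inter_Ioo X _ _), beadCount]

theorem Ico_succ_eq_Ioc (t : ℕ) (m : ℤ) : Set.Ico (m + 1 - t) (m + 1) = Set.Ioc (m - t) m := by
  ext z
  simp only [Set.mem_Ico, Set.mem_Ioc]
  omega

theorem ncard_inter_Ico_succ_of_notMem {X : Set ℤ} {t : ℕ} (ht : 0 < t) {m : ℤ} (hm : m ∉ X) :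
    (X ∩ Set.Ico (m + 1 - t) (m + 1)).ncard = beadCount X t m := by
  rw [Ico_succ_eq_Ioc, ← Set.Ioo_insert_right (by omega), Set.inter_insert_of_notMem hm, beadCount]

/-- Advancing the window by one admits only `m`, and if `m ∈ X` then the discarded point `m - t` was
in `X` too. -/
theorem antitone_ncard_inter_Ico {X : Set ℤ} {t : ℕ} (ht : 0 < t) (hX : ∀ y ∈ X, y - (t : ℤ) ∈ X) :
    Antitone fun m : ℤ => (X ∩ Set.Ico (m - t) m).ncard := by
  refine antitone_int_of_succ_le fun m => ?_
  by_cases hm : m ∈ X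
  · rw [ncard_inter_Ico_of_mem ht (hX m hm), Ico_succ_eq_Ioc, ← Set.Ioo_insert_right (by omega),
      Set.inter_insert_of_mem hm]
    exact Set.ncard_insert_le _ _
  · rw [ncard_inter_Ico_succ_of_notMem ht hm]
    exact Set.ncard_le_ncard (Set.inter_subset_inter_right _ Set.Ioo_subset_Ico_self)
      ((Set.finite_Ico _ _).inter_of_right X)

/-- On a `t`-core, the leg length determines how a `t`-hook is added. -/
theorem eq_of_beadCount_eq {X : Set ℤ} {t : ℕ} (ht : 0 < t) (hX : ∀ y ∈ X, y - (t : ℤ) ∈ X)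
    {z z' : ℤ} (hz : z ∉ X) (hz' : z' ∉ X) (hzt : z - t ∈ X) (hzt' : z' - t ∈ X)
    (h : beadCount X t z = beadCount X t z') : z = z' := by
  -- Compare the windows ending before `u + 1` and before `v`: the first has `beadCount X t u`
  -- elements, the second one more than `beadCount X t v` because it contains `v - t`.
  have key : ∀ u v : ℤ, u ∉ X → v - t ∈ X → u < v → beadCount X t v < beadCount X t u := by
    intro u v hu hv huv
    have := antitone_ncard_inter_Ico ht hX (show u + 1 ≤ v from huv)
    dsimp only at this
    rw [ncard_inter_Ico_of_mem ht hv, ncard_inter_Ico_succ_of_notMem ht hu] at this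
    omega
  rcases lt_trichotomy z z' with h1 | h1 | h1
  · have := key _ _ hz hzt' h1
    omega
  · exact h1
  · have := key _ _ hz' hzt h1
    omega

theorem beadCount_congr {X Y : Set ℤ} {t : ℕ} {x : ℤ}
    (h : ∀ z, x - t < z → z < x → (z ∈ X ↔ z ∈ Y)) : beadCount X t x = beadCount Y t x := by
  rw [beadCount, beadCount]
  congr 1
  ext z
  simp only [Set.mem_inter_iff, Set.mem_Ioo]
  grind

theorem beadCount_eq_succ {X Y : Set ℤ} {t : ℕ} (ht : 1 < t) {x : ℤ}
    (h : ∀ z, x - t + 1 < z → z < x → (z ∈ X ↔ z ∈ Y)) (hx : x - t + 1 ∈ X ↔ x ∈ Y) :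
    beadCount X t x = beadCount Y t (x + 1) := by
  have h1 : Set.Ioo (x - t) x = insert (x - t + 1) (Set.Ioo (x - t + 1) x) := by
    ext z
    simp only [Set.mem_insert_iff, Set.mem_Ioo]
    omega
  have h2 : Set.Ioo (x + 1 - t) (x + 1) = insert x (Set.Ioo (x - t + 1) x) := by
    ext z
    simp only [Set.mem_insert_iff, Set.mem_Ioo]
    omega
  have h3 : X ∩ Set.Ioo (x - t + 1) x = Y ∩ Set.Ioo (x - t + 1) x := by
    ext z
    simp only [Set.mem_inter_iff, Set.mem_Ioo]
    grind
  have hfin := finite_inter_Ioo Y (x - t + 1) x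
  rw [beadCount, beadCount, h1, h2]
  by_cases hY : x ∈ Y
  · rw [Set.inter_insert_of_mem (hx.2 hY), Set.inter_insert_of_mem hY, h3,
      Set.ncard_insert_of_notMem (by simp) hfin, Set.ncard_insert_of_notMem (by simp) hfin]
  · rw [Set.inter_insert_of_notMem (hx.not.2 hY), Set.inter_insert_of_notMem hY, h3]

theorem mem_of_card_lt {μ : YoungDiagram} {t : ℕ} (ht : 0 < t) (h : μ.card < t) {y : ℤ}
    (hy : y ∈ μ.beads) : y - (t : ℤ) ∈ μ.beads := by
  by_contra hn
  obtain ⟨ν, hν⟩ := exists_movesBead ht hy hn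
  have := hν.card
  omega

/-- A second movable bead would stay movable in `ν`, which has fewer than `t` cells. -/
theorem MovesBead.eq_of_card_lt {μ ν : YoungDiagram} {t : ℕ} (h : μ.card < 2 * t) {x y : ℤ}
    (hx : MovesBead μ ν x (x - t)) (hy : y ∈ μ.beads) (hyt : y - t ∉ μ.beads) : y = x := by
  have ht := hx.lt
  by_contra hne
  have h1 : y ∈ ν.beads := (hx.mem_iff y).2 (Or.inr ⟨hy, hne⟩)
  have h2 : y - t ∉ ν.beads := fun h => by
    rcases (hx.mem_iff _).1 h with h | h
    · omega
    · exact hyt h.1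
  have := hx.card
  exact h2 (mem_of_card_lt (by omega) (by omega) h1)

theorem MovesBead.beadCount_eq {μ ν : YoungDiagram} {t : ℕ} {x : ℤ}
    (h : MovesBead μ ν x (x - t)) : beadCount μ.beads t x = beadCount ν.beads t x := by
  refine beadCount_congr fun z h1 h2 => ?_
  rw [h.mem_iff]
  grind

/-- The two excluded cases are those where the bead crosses an end of the open window. -/
theorem MovesBead.beadCount_eq_of_ne {la mu : YoungDiagram} {t : ℕ} {b x : ℤ}
    (h : MovesBead la mu (b + 1) b) (h1 : b + 1 ≠ x) (h2 : b ≠ x - t) :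
    beadCount la.beads t x = beadCount mu.beads t x := by
  by_cases hin : x - t < b ∧ b + 1 < x
  · have e1 : la.beads ∩ Set.Ioo (x - t) x =
        insert (b + 1) ((la.beads \ {b + 1}) ∩ Set.Ioo (x - t) x) := by
      have := h.mem
      ext z
      simp only [Set.mem_inter_iff, Set.mem_Ioo, Set.mem_insert_iff, Set.mem_sdiff,
        Set.mem_singleton_iff]
      grind
    have e2 : mu.beads ∩ Set.Ioo (x - t) x =
        insert b ((la.beads \ {b + 1}) ∩ Set.Ioo (x - t) x) := by
      ext z
      simp only [Set.mem_inter_iff, Set.mem_Ioo, Set.mem_insert_iff, Set.mem_sdiff,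
        Set.mem_singleton_iff, h.mem_iff]
      grind
    have hfin := finite_inter_Ioo (la.beads \ {b + 1}) (x - t) x
    rw [beadCount, beadCount, e1, e2, Set.ncard_insert_of_notMem (by simp) hfin,
      Set.ncard_insert_of_notMem (fun hb => h.notMem hb.1.1) hfin]
  · refine beadCount_congr fun z hz1 hz2 => ?_
    rw [h.mem_iff]
    have hz3 : z ≠ b := by omega
    have hz4 : z ≠ b + 1 := by omega
    tauto

/-! ### Covers and cores -/

/-- Cover relations descend to cores, with equal leg lengths. -/
theorem movesBead_core {la mu α β : YoungDiagram} {t : ℕ} (ht : 1 < t)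
    (hcard : la.card < 2 * t) {b x y : ℤ} (hb : MovesBead la mu (b + 1) b)
    (hx : MovesBead la β x (x - t)) (hy : MovesBead mu α y (y - t)) :
    beadCount la.beads t x = beadCount mu.beads t y ∧ ∃ b', MovesBead β α (b' + 1) b' := by
  have hcard' : mu.card < 2 * t := by
    have : MovesBead la mu (b + 1) (b + 1 - (1 : ℕ)) := by simpa using hb
    have := this.card
    omega
  have uL := fun w => hx.eq_of_card_lt hcard (y := w)
  have uM := fun w => hy.eq_of_card_lt hcard' (y := w)
  -- Fewer than `2 * t` cells also rule out `2t`-hooks.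
  have nL := fun w => mem_of_card_lt (by omega) hcard (y := w)
  have nM := fun w => mem_of_card_lt (by omega) hcard' (y := w)
  push_cast at nL nM
  have hcount := fun z => hb.beadCount_eq_of_ne (t := t) (x := z)
  obtain ⟨b1, b2, -, hb⟩ := hb
  obtain ⟨x1, x2, -, hx⟩ := hx
  obtain ⟨y1, y2, -, hy⟩ := hy
  simp only [hb] at uM nM y1 y2 hy
  -- The same bead makes both moves, so `x = b + 1` and the cores differ by a unit move `t` lower.
  by_cases h1 : y = b
  · subst h1
    have h2 : y + 1 = x := by grind
    subst h2
    refine ⟨(beadCount_eq_succ ht (fun z _ _ => ?_) ?_).symm, y - t, ?_, ?_, by omega,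
      fun z => ?_⟩ <;> simp only [hx, hy, hb] <;> grind
  -- The move by `t` in `mu` lands where the unit move left; in `la` it must land on `b`, so `x = b
  -- + t`, and the cores differ by a unit move `t` higher.
  · by_cases h2 : y - t = b + 1
    · have h3 : b + t = x := by grind
      subst h3
      obtain rfl : y = b + t + 1 := by omega
      refine ⟨beadCount_eq_succ ht (fun z _ _ => ?_) ?_, b + t, ?_, ?_, by omega,
        fun z => ?_⟩ <;> simp only [hx, hy, hb] <;> grind
    · have h3 : y = x := by grind
      subst h3
      refine ⟨hcount y (by grind) (by grind), b, ?_, ?_, by omega,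
        fun z => ?_⟩ <;> simp only [hx, hy] <;> grind

/-- Cover relations lift from cores when the leg lengths agree. -/
theorem movesBead_of_core {la mu α β : YoungDiagram} {t : ℕ} (ht : 1 < t)
    (hα : α.card < t) (hβ : β.card < t) {b x y : ℤ} (hb : MovesBead β α (b + 1) b)
    (hx : MovesBead la β x (x - t)) (hy : MovesBead mu α y (y - t))
    (h : beadCount la.beads t x = beadCount mu.beads t y) :
    ∃ b', MovesBead la mu (b' + 1) b' := by
  have nα := fun w => mem_of_card_lt (by omega) hα (y := w)
  have nβ := fun w => mem_of_card_lt (by omega) hβ (y := w)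
  rw [hx.beadCount_eq, hy.beadCount_eq] at h
  -- On the core `α`, equal bead counts identify `y`; each case below proposes the position that `y`
  -- must have.
  have key := fun z => eq_of_beadCount_eq (by omega) nα (z := z) (z' := y)
  have hcount := fun z => hb.beadCount_eq_of_ne (t := t) (x := z)
  obtain ⟨b1, b2, -, hb⟩ := hb
  obtain ⟨x1, x2, -, hx⟩ := hx
  obtain ⟨y1, y2, -, hy⟩ := hy
  have la_iff : ∀ z, z ∈ la.beads ↔ z = x ∨ (z ∈ β.beads ∧ z ≠ x - t) := by
    intro z
    rw [hx]
    grind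
  have mu_iff : ∀ z, z ∈ mu.beads ↔ z = y ∨ (z ∈ α.beads ∧ z ≠ y - t) := by
    intro z
    rw [hy]
    grind
  have zn : x ∉ β.beads := by
    rw [hx]
    grind
  have wn : y ∉ α.beads := by
    rw [hy]
    grind
  have zt : x - t ∈ β.beads := (hx _).2 (Or.inl rfl)
  have wt : y - t ∈ α.beads := (hy _).2 (Or.inl rfl)
  clear hx hy x1 x2 y1 y2
  by_cases h1 : x = b
  · subst h1
    have h2 : x + 1 - t ∈ α.beads := by grind
    have h3 : x + 1 = y := by
      refine key _ ?_ wn h2 wt ?_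
      · grind
      · rw [← h]
        exact (beadCount_eq_succ ht (fun z _ _ => by grind) (by grind)).symm
    subst h3
    refine ⟨x - t, ?_, ?_, by omega, fun z => ?_⟩ <;> simp only [la_iff, mu_iff] <;> grind
  · by_cases h2 : x - t = b + 1
    · obtain rfl : x = b + t + 1 := by omega
      have h3 : b + t ∉ α.beads := by grind
      have h4 : b + t = y := by
        refine key _ h3 wn ?_ wt ?_
        · grind
        · rw [← h]
          exact beadCount_eq_succ ht (fun z _ _ => by grind) (by grind)
      subst h4
      refine ⟨b + t, ?_, ?_, by omega, fun z => ?_⟩ <;> simp only [la_iff, mu_iff] <;> grind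
    · have h3 : x = y := by
        refine key _ ?_ wn ?_ wt ?_
        · grind
        · grind
        · rw [← h]
          refine (hcount x ?_ ?_).symm <;> grind
      subst h3
      refine ⟨b, ?_, ?_, by omega, fun z => ?_⟩ <;> simp only [la_iff, mu_iff] <;> grind

/-! ### Back to hooks and cores of partitions -/

theorem IsHookAt.eq_of_card_lt {μ : YoungDiagram} {t : ℕ} {c d : ℕ × ℕ} (h : μ.card < 2 * t)
    (hc : μ.IsHookAt t c) (hd : μ.IsHookAt t d) : d = c :=
  hd.eq_of_bead_eq hc (hc.movesBead.eq_of_card_lt h hd.movesBead.mem hd.movesBead.notMem)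

theorem not_isHookAt_of_card_lt {μ : YoungDiagram} {t : ℕ} (h : μ.card < t) (c : ℕ × ℕ) :
    ¬ μ.IsHookAt t c := fun hc => by
  have := hc.card_removeHook
  omega

theorem IsHookAt.isCoreOf_iff {μ ν : YoungDiagram} {t : ℕ} {c : ℕ × ℕ} (h : μ.card < 2 * t)
    (hc : μ.IsHookAt t c) : IsCoreOf t ν μ ↔ ν = μ.removeHook c := by
  have hcard := hc.card_removeHook
  have hno := not_isHookAt_of_card_lt (μ := μ.removeHook c) (t := t) (by omega)
  constructor
  · rintro ⟨hpath, hν⟩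
    rcases Relation.ReflTransGen.cases_head hpath with rfl | ⟨ρ, ⟨d, hd, rfl⟩, hpath⟩
    · exact (hν c hc).elim
    · obtain rfl := hc.eq_of_card_lt h hd
      rcases Relation.ReflTransGen.cases_head hpath with he | ⟨ρ, ⟨e, he, -⟩, -⟩
      · exact he.symm
      · exact (hno e he).elim
  · rintro rfl
    exact ⟨Relation.ReflTransGen.single ⟨c, hc, rfl⟩, hno⟩

theorem isOdd_iff_exists_isHookAt {μ : YoungDiagram} {k : ℕ} (h1 : 2 ^ k ≤ μ.card)
    (h2 : μ.card < 2 * 2 ^ k) :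
    μ.IsOdd ↔ ∃ c, μ.IsHookAt (2 ^ k) c ∧ (μ.removeHook c).IsOdd := by
  have hsum := numChains_mod_two h1
  rw [IsOdd, ← ZMod.natCast_ne_zero_iff_odd, hsum]
  by_cases hex : ∃ c, μ.IsHookAt (2 ^ k) c
  · obtain ⟨c, hc⟩ := hex
    have hm := hc.movesBead
    have hmov : μ.movable (2 ^ k) = {μ.bead c.1} := by
      ext x
      rw [mem_movable (by positivity), Finset.mem_singleton]
      refine ⟨fun hx => hm.eq_of_card_lt h2 hx.1 hx.2, ?_⟩
      rintro rfl
      exact ⟨hm.mem, hm.notMem⟩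
    rw [hookSum, hmov, Finset.sum_singleton, hm.slide_eq, ZMod.natCast_ne_zero_iff_odd]
    constructor
    · exact fun h => ⟨c, hc, h⟩
    · rintro ⟨d, hd, h⟩
      obtain rfl := hc.eq_of_card_lt h2 hd
      exact h
  · have hmov : μ.movable (2 ^ k) = ∅ := by
      refine Finset.eq_empty_of_forall_notMem fun x hx => hex ?_
      obtain ⟨c, hc, -⟩ := (movesBead_slide (by positivity) hx).exists_isHookAt
      exact ⟨c, hc⟩
    rw [hookSum, hmov, Finset.sum_empty]
    refine ⟨fun h => (h rfl).elim, fun ⟨c, hc, _⟩ => (hex ⟨c, hc⟩).elim⟩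

theorem eq_of_removeHook_eq {μ ν : YoungDiagram} {t : ℕ} {c d : ℕ × ℕ} (h : μ.card < 2 * t)
    (hc : μ.IsHookAt t c) (hd : ν.IsHookAt t d) (hleg : μ.legLength c = ν.legLength d)
    (hcore : μ.removeHook c = ν.removeHook d) : μ = ν := by
  have ht := hc.pos
  have hcard := hc.card_removeHook
  have h1 := hc.movesBead
  have h2 := hd.movesBead
  have hcount : beadCount μ.beads t (μ.bead c.1) = beadCount ν.beads t (ν.bead d.1) :=
    hc.legLength_eq.symm.trans (hleg.trans hd.legLength_eq)
  rw [h1.beadCount_eq, h2.beadCount_eq] at hcount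
  rw [← hcore] at h2 hcount
  have hclosed := fun w => mem_of_card_lt ht (μ := μ.removeHook c) (by omega) (y := w)
  -- Both partitions come from the same core by raising one bead by `t`; equal leg-lengths force the
  -- same bead.
  have hx := eq_of_beadCount_eq ht hclosed
    (fun h => by rcases (h1.mem_iff _).1 h with h | h <;> [have := h1.lt; skip] <;> omega)
    (fun h => by rcases (h2.mem_iff _).1 h with h | h <;> [have := h2.lt; skip] <;> omega)
    ((h1.mem_iff _).2 (Or.inl rfl)) ((h2.mem_iff _).2 (Or.inl rfl)) hcount
  rw [← hx] at h2
  refine beads_injective (Set.ext fun z => ?_)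
  have e1 := h1.mem_iff z
  have e2 := h2.mem_iff z
  have := h1.mem
  have := h2.mem
  have := h1.notMem
  have := h2.notMem
  grind

theorem covBy_iff_of_isHookAt {la mu : YoungDiagram} {t : ℕ} {c d : ℕ × ℕ} (ht : 1 < t)
    (hla : la.card < 2 * t) (hmu : mu.card < 2 * t) (hc : la.IsHookAt t c)
    (hd : mu.IsHookAt t d) :
    mu ⋖ la ↔ la.legLength c = mu.legLength d ∧ mu.removeHook d ⋖ la.removeHook c := by
  have h1 := hc.card_removeHook
  have h2 := hd.card_removeHook
  rw [covBy_iff_movesBead, covBy_iff_movesBead, hc.legLength_eq, hd.legLength_eq]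
  constructor
  · rintro ⟨b, hb⟩
    exact movesBead_core ht hla hb hc.movesBead hd.movesBead
  · rintro ⟨h, b, hb⟩
    exact movesBead_of_core ht (by omega) (by omega) hb hc.movesBead hd.movesBead h

end YoungDiagram

theorem mainTheorem3 (n k : ℕ) (hkn : 2 ^ k ≤ n) (hnk : n < 2 ^ (k + 1)) :
    -- a partition of `n` has at most one `2 ^ k`-hook, and removing it yields the `2 ^ k`-core,
    -- which is a partition of `n - 2 ^ k`
    (∀ (la : YoungDiagram) (c : ℕ × ℕ), la.card = n → la.IsHookAt (2 ^ k) c →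
      (∀ d, la.IsHookAt (2 ^ k) d → d = c) ∧
      (la.removeHook c).card = n - 2 ^ k ∧
      (∀ ν, YoungDiagram.IsCoreOf (2 ^ k) ν la ↔ ν = la.removeHook c)) ∧
    -- characterization of odd partitions
    (∀ la : YoungDiagram, la.card = n →
      (la.IsOdd ↔ ∃ c, la.IsHookAt (2 ^ k) c ∧ (la.removeHook c).IsOdd)) ∧
    -- an odd partition is determined by its `2 ^ k`-core and the leg length of its `2 ^ k`-hook
    (∀ (la la' ν : YoungDiagram) (c c' : ℕ × ℕ), la.card = n → la'.card = n →
      la.IsOdd → la'.IsOdd → la.IsHookAt (2 ^ k) c → la'.IsHookAt (2 ^ k) c' →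
      la.legLength c = la'.legLength c' → YoungDiagram.IsCoreOf (2 ^ k) ν la → YoungDiagram.IsCoreOf (2 ^ k) ν la' →
      la = la') ∧
    -- cover relations
    (2 ^ k < n → ∀ la mu : YoungDiagram, la.card = n → (∃ c, la.IsHookAt (2 ^ k) c) →
      mu.card = n - 1 → mu.IsOdd →
      (mu ⋖ la ↔
        (∃ c d, la.IsHookAt (2 ^ k) c ∧ mu.IsHookAt (2 ^ k) d ∧
          la.legLength c = mu.legLength d) ∧
        ∃ α β, YoungDiagram.IsCoreOf (2 ^ k) α mu ∧ YoungDiagram.IsCoreOf (2 ^ k) β la ∧ α ⋖ β)) := by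

  rw [pow_succ'] at hnk
  have core_iff := fun (la ν : YoungDiagram) (c : ℕ × ℕ) (hla : la.card = n)
    (hc : la.IsHookAt (2 ^ k) c) => hc.isCoreOf_iff (ν := ν) (hla ▸ hnk)
  refine ⟨fun la c hla hc => ⟨fun d hd => hc.eq_of_card_lt (hla ▸ hnk) hd, ?_,
    fun ν => core_iff la ν c hla hc⟩, fun la hla =>
    YoungDiagram.isOdd_iff_exists_isHookAt (hla ▸ hkn) (hla ▸ hnk), ?_, ?_⟩
  · have := hc.card_removeHook
    omega
  · intro la la' ν c c' hla hla' _ _ hc hc' hleg hν hν'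
    rw [core_iff la ν c hla hc] at hν
    rw [core_iff la' ν c' hla' hc'] at hν'
    exact YoungDiagram.eq_of_removeHook_eq (hla ▸ hnk) hc hc' hleg (hν.symm.trans hν')
  · rintro hlt la mu hla ⟨c, hc⟩ hmu hodd
    have hmu2 : mu.card < 2 * 2 ^ k := by omega
    obtain ⟨d, hd, -⟩ := (YoungDiagram.isOdd_iff_exists_isHookAt (by omega) hmu2).1 hodd
    -- If `2 ^ k = 1`, no `n` satisfies `1 < n < 2`.
    have ht : 1 < 2 ^ k := by
      by_contra! h
      have : 0 < 2 ^ k := by positivity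
      omega
    rw [YoungDiagram.covBy_iff_of_isHookAt ht (hla ▸ hnk) hmu2 hc hd]
    constructor
    · rintro ⟨hleg, hcov⟩
      exact ⟨⟨c, d, hc, hd, hleg⟩, _, _, (hd.isCoreOf_iff hmu2).2 rfl,
        (core_iff la _ c hla hc).2 rfl, hcov⟩
    · rintro ⟨⟨c', d', hc', hd', hleg⟩, α, β, hα, hβ, hcov⟩
      obtain rfl := hc.eq_of_card_lt (hla ▸ hnk) hc'
      obtain rfl := hd.eq_of_card_lt hmu2 hd'
      rw [hd.isCoreOf_iff hmu2] at hα
      rw [core_iff la β _ hla hc] at hβ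
      subst hα hβ
      exact ⟨hleg, hcov⟩
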